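/- Let $q\ge 1$, $k\ge 0$ and $t>0$. For an integer $n\ge1$ let $\phi_n:\mathbb{R}\to\mathbb{R}$ be the unique $C^2$ solution of the Bessel equation $$\phi''(r)+(n-1)\frac{\phi'(r)}{r}+\phi(r)=0\ (r\neq0),\qquad \phi(0)=1,\ \phi'(0)=0,$$ that is, $\phi_n(r)=\sum_{m\ge0} r^{2m}\prod_{j=1}^m\frac{1}{(-2j)(n-2+2j)}$. On complex-valued differential forms on $\mathbb{R}^q$ let $d$ be the exterior derivative, $d^*$ its formal adjoint and $D=d+d^*$ the Dirac operator. Since $\phi_n$ is even, $\phi_n(tD)$ is a function of the Hodge Laplacian $D^2=-\Delta$ and preserves degrees: on smooth compactly supported forms it is multiplication of the Fourier transform by $\phi_n(2\pi t|\xi|)$, and it extends to $L^2$ forms as the closure in $L^2$. Likewise $d_t=t\,\phi_{q+2}(tD)\,d$ is defined on smooth compactly supported forms and extended to $L^2$ forms as the closure in $L^2$. For $p\in\mathbb{R}^q$ let $W_t(p)=\{x:|x-p|=t\}$ be the wave front. **Theorem (Strong Huygens).** a) For every continuous $k$-form $f\in L^2$, the form $d_tf$ is defined and has exactly one continuous representative,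 and for every $p$ the value $d_tf(p)$ depends only on the restriction $f|_{W_t(p)}$: if $f_1,f_2$ are continuous $L^2$ $k$-forms with $f_1=f_2$ at all points of $W_t(p)$, then $d_tf_1(p)=d_tf_2(p)$. b) For every $C^1$ $k$-form $f$ with $df\in L^2$, the form $\phi_q(tD)\,df$ is defined and has exactly one continuous representative, and for every $p$ its value at $p$ depends only on $f$ and its first normal derivative on $W_t(p)$: if $f_1,f_2$ are $C^1$ $k$-forms with $df_1,df_2\in L^2$ such that $f_1=f_2$ and $\partial_{x-p}f_1(x)=\partial_{x-p}f_2(x)$ at all $x\in W_t(p)$, then $\phi_q(tD)\,df_1(p)=\phi_q(tD)\,df_2(p)$. In particular it depends only on $f$ in an arbitrarily small neighbourhood of $W_t(p)$. -/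

import Mathlib

open MeasureTheory Filter Topology
open scoped FourierTransform ContDiff Laplacian

/-- The `k`-th coefficient `1 / ∏_{j=1}^{k} (-2j)(n - 2 + 2j)` (the index is shifted by one). -/
noncomputable def besselCoeff (n k : ℕ) : ℝ :=
  ∏ j ∈ Finset.range k, (-(2 * ((j : ℝ) + 1)) * ((n : ℝ) + 2 * j))⁻¹

/-- The function `φ_n(r) = ∑ₖ bₖ r^{2k}`. -/
noncomputable def besselPhi (n : ℕ) (r : ℝ) : ℝ :=
  ∑' k : ℕ, besselCoeff n k * r ^ (2 * k)

/-- `f` is a solution of `f'' + (n-1) f'/r + f = 0` with `f(0) = 1`, `f'(0) = 0`. -/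
structure IsBesselSolution (n : ℕ) (f : ℝ → ℝ) : Prop where
  contDiff : ContDiff ℝ 2 f
  ode : ∀ r : ℝ, r ≠ 0 → deriv (deriv f) r + ((n : ℝ) - 1) * (deriv f r / r) + f r = 0
  map_zero : f 0 = 1
  deriv_zero : deriv f 0 = 0

theorem hasDerivAt_powerSum {c : ℕ → ℝ} (hc : ∀ k, |c k| ≤ 1 / (k.factorial : ℝ)) (s : ℝ) :
    HasDerivAt (fun x : ℝ => ∑' k, c k * x ^ k) (∑' k : ℕ, ((k : ℝ) + 1) * c (k + 1) * s ^ k) s := by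
  set R : ℝ := |s| + 1 with hR
  have hRpos : 0 < R := by positivity
  have hu : Summable (fun k : ℕ => (k : ℝ) * R ^ (k - 1) / (k.factorial : ℝ)) := by
    rw [← summable_nat_add_iff 1]
    refine (Real.summable_pow_div_factorial R).congr fun k => ?_
    rw [Nat.factorial_succ]
    have : (k.factorial : ℝ) ≠ 0 := by positivity
    push_cast
    field_simp
  have hmem : s ∈ Metric.ball (0 : ℝ) R := by simp [hR]
  have hb : ∀ (k : ℕ), ∀ y ∈ Metric.ball (0 : ℝ) R,
      ‖c k * (k * y ^ (k - 1))‖ ≤ (k : ℝ) * R ^ (k - 1) / (k.factorial : ℝ) := by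
    intro k y hy
    have hy' : |y| ≤ R := by simpa using (mem_ball_zero_iff.1 hy).le
    rw [Real.norm_eq_abs, abs_mul, abs_mul, abs_pow, Nat.abs_cast, div_eq_mul_one_div, mul_comm]
    gcongr
    exact hc k
  have hd := hasDerivAt_tsum_of_isPreconnected (g := fun k x => c k * x ^ k)
    (g' := fun k x => c k * (k * x ^ (k - 1))) (y₀ := 0) (y := s) hu Metric.isOpen_ball
    (convex_ball (0 : ℝ) R).isPreconnected
    (fun k y _ => (hasDerivAt_pow k y).const_mul (c k)) hb (by simpa using hRpos)
    (summable_of_ne_finset_zero (s := {0}) (fun k hk => by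
      have : k ≠ 0 := by simpa using hk
      simp [this])) hmem
  refine hd.congr_deriv ?_
  have hs : Summable (fun k : ℕ => c k * (k * s ^ (k - 1))) :=
    Summable.of_norm_bounded hu (fun k => hb k s hmem)
  rw [hs.tsum_eq_zero_add]
  simp only [CharP.cast_eq_zero, zero_mul, mul_zero, zero_add, Nat.add_sub_cancel]
  exact tsum_congr fun k => by push_cast; ring

theorem abs_shift_le {c : ℕ → ℝ} (hc : ∀ k, |c k| ≤ 1 / (k.factorial : ℝ)) (k : ℕ) :
    |((k : ℝ) + 1) * c (k + 1)| ≤ 1 / (k.factorial : ℝ) := by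
  have h := hc (k + 1)
  rw [Nat.factorial_succ] at h
  rw [abs_mul, abs_of_pos (by positivity : (0 : ℝ) < (k : ℝ) + 1)]
  calc ((k : ℝ) + 1) * |c (k + 1)| ≤ ((k : ℝ) + 1) * (1 / (((k + 1) * k.factorial : ℕ) : ℝ)) := by
        gcongr
    _ = 1 / (k.factorial : ℝ) := by push_cast; field_simp

theorem summable_powerSum {c : ℕ → ℝ} (hc : ∀ k, |c k| ≤ 1 / (k.factorial : ℝ)) (s : ℝ) :
    Summable (fun k => c k * s ^ k) := by
  refine Summable.of_norm_bounded (Real.summable_pow_div_factorial |s|) fun k => ?_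
  rw [Real.norm_eq_abs, abs_mul, abs_pow, div_eq_mul_one_div, mul_comm]
  gcongr
  exact hc k

theorem besselCoeff_succ (n k : ℕ) : besselCoeff n (k + 1) =
    besselCoeff n k * (-(2 * ((k : ℝ) + 1)) * ((n : ℝ) + 2 * k))⁻¹ := by
  rw [besselCoeff, Finset.prod_range_succ]; rfl

theorem abs_besselCoeff_le {n : ℕ} (hn : 1 ≤ n) (k : ℕ) :
    |besselCoeff n k| ≤ 1 / (k.factorial : ℝ) := by
  have hn' : (1 : ℝ) ≤ n := by exact_mod_cast hn
  induction k with
  | zero => simp [besselCoeff]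
  | succ k ih =>
    rw [besselCoeff_succ, abs_mul, abs_inv, abs_mul, abs_neg,
      abs_of_pos (by positivity : (0 : ℝ) < 2 * ((k : ℝ) + 1)),
      abs_of_pos (by positivity : (0 : ℝ) < (n : ℝ) + 2 * k), Nat.factorial_succ]
    push_cast
    have h : (2 * ((k : ℝ) + 1) * ((n : ℝ) + 2 * k))⁻¹ ≤ ((k : ℝ) + 1)⁻¹ := by
      gcongr
      nlinarith [(Nat.cast_nonneg k : (0 : ℝ) ≤ k)]
    calc _ ≤ 1 / (k.factorial : ℝ) * ((k : ℝ) + 1)⁻¹ := by gcongr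
      _ = _ := by field_simp

theorem isBesselSolution_besselPhi {n : ℕ} (hn : 1 ≤ n) : IsBesselSolution n (besselPhi n) := by
  set c := besselCoeff n with hcdef
  have hn' : (1 : ℝ) ≤ n := by exact_mod_cast hn
  have hc : ∀ k, |c k| ≤ 1 / (k.factorial : ℝ) := abs_besselCoeff_le hn
  set c1 : ℕ → ℝ := fun k => ((k : ℝ) + 1) * c (k + 1) with hc1def
  have hc1 : ∀ k, |c1 k| ≤ 1 / (k.factorial : ℝ) := abs_shift_le hc
  set c2 : ℕ → ℝ := fun k => ((k : ℝ) + 1) * c1 (k + 1) with hc2def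
  have hc2 : ∀ k, |c2 k| ≤ 1 / (k.factorial : ℝ) := abs_shift_le hc1
  set F : ℝ → ℝ := fun s => ∑' k, c k * s ^ k with hF
  set F1 : ℝ → ℝ := fun s => ∑' k, c1 k * s ^ k with hF1
  set F2 : ℝ → ℝ := fun s => ∑' k, c2 k * s ^ k with hF2
  have hφ : besselPhi n = fun r => F (r ^ 2) := by
    funext r; simp only [besselPhi, hF, pow_mul]; rfl
  have dF : ∀ s, HasDerivAt F (F1 s) s := hasDerivAt_powerSum hc
  have dF1 : ∀ s, HasDerivAt F1 (F2 s) s := hasDerivAt_powerSum hc1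
  have dF2 : ∀ s, DifferentiableAt ℝ F2 s := fun s => (hasDerivAt_powerSum hc2 s).differentiableAt
  have dsq : ∀ r : ℝ, HasDerivAt (fun x : ℝ => x ^ 2) (2 * r) r := fun r => by
    simpa using hasDerivAt_pow 2 r
  have d1 : ∀ r, HasDerivAt (besselPhi n) (F1 (r ^ 2) * (2 * r)) r := fun r => by
    rw [hφ]; exact (dF (r ^ 2)).comp r (dsq r)
  have e1 : deriv (besselPhi n) = fun r => F1 (r ^ 2) * (2 * r) := funext fun r => (d1 r).deriv
  have d2 : ∀ r, HasDerivAt (fun r => F1 (r ^ 2) * (2 * r))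
      (F2 (r ^ 2) * (2 * r) * (2 * r) + F1 (r ^ 2) * 2) r := fun r => by
    have := ((dF1 (r ^ 2)).comp r (dsq r)).mul ((hasDerivAt_id r).const_mul 2)
    exact this.congr_deriv (by simp)
  have e2 : deriv (deriv (besselPhi n)) =
      fun r => F2 (r ^ 2) * (2 * r) * (2 * r) + F1 (r ^ 2) * 2 := by
    rw [e1]; exact funext fun r => (d2 r).deriv
  have cF2 : Continuous F2 := Differentiable.continuous dF2
  have cF1 : Continuous F1 := Differentiable.continuous fun s => (dF1 s).differentiableAt
  have hode : ∀ s, 4 * s * F2 s + 2 * n * F1 s + F s = 0 := by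
    intro s
    have s2 := (summable_powerSum hc2 s)
    have s1 := (summable_powerSum hc1 s)
    have s0 := (summable_powerSum hc s)
    have h2 : s * F2 s = ∑' k : ℕ, (k : ℝ) * c1 k * s ^ k := by
      have hs : Summable (fun k : ℕ => (k : ℝ) * c1 k * s ^ k) := by
        rw [← summable_nat_add_iff 1]
        refine (s2.mul_left s).congr fun k => ?_
        simp only [hc2def]; push_cast; ring
      rw [hs.tsum_eq_zero_add, hF2]
      simp only [← tsum_mul_left]
      simp only [CharP.cast_eq_zero, zero_mul, zero_add]
      exact tsum_congr fun k => by simp only [hc2def]; push_cast; ring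
    have hs : Summable (fun k : ℕ => (k : ℝ) * c1 k * s ^ k) := by
      rw [← summable_nat_add_iff 1]
      refine (s2.mul_left s).congr fun k => ?_
      simp only [hc2def]; push_cast; ring
    calc 4 * s * F2 s + 2 * n * F1 s + F s
        = 4 * (s * F2 s) + 2 * n * F1 s + F s := by ring
      _ = ∑' k : ℕ, (4 * ((k : ℝ) * c1 k * s ^ k) + 2 * n * (c1 k * s ^ k) + c k * s ^ k) := by
        rw [h2, hF1, hF, Summable.tsum_add ((hs.mul_left 4).add (s1.mul_left _)) s0,
          Summable.tsum_add (hs.mul_left 4) (s1.mul_left _), tsum_mul_left, tsum_mul_left]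
      _ = ∑' k : ℕ, (0 : ℝ) := tsum_congr fun k => by
        have h : c (k + 1) * (-(2 * ((k : ℝ) + 1)) * ((n : ℝ) + 2 * k)) = c k := by
          rw [hcdef, besselCoeff_succ, mul_assoc, inv_mul_cancel₀, mul_one]
          have : (0 : ℝ) < 2 * ((k : ℝ) + 1) * ((n : ℝ) + 2 * k) := by positivity
          nlinarith
        rw [← h]; simp only [hc1def]; ring
      _ = 0 := tsum_zero
  refine ⟨?_, ?_, ?_, ?_⟩
  · rw [show (2 : WithTop ℕ∞) = 1 + 1 by norm_num, contDiff_succ_iff_deriv]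
    refine ⟨fun r => (d1 r).differentiableAt, by simp, ?_⟩
    rw [contDiff_one_iff_deriv]
    refine ⟨?_, ?_⟩
    · rw [e1]; exact fun r => (d2 r).differentiableAt
    · rw [e2]; fun_prop
  · intro r hr
    rw [e2, e1, hφ]
    have := hode (r ^ 2)
    field_simp
    linear_combination this
  · simp only [besselPhi]
    rw [tsum_eq_single 0 (fun k hk => by simp [hk])]
    simp [besselCoeff]
  · rw [e1]; simp

theorem IsBesselSolution.unique {n : ℕ} (hn : 1 ≤ n) {f g : ℝ → ℝ} (hf : IsBesselSolution n f)
    (hg : IsBesselSolution n g) : f = g := by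
  have hn' : (0 : ℝ) ≤ (n : ℝ) - 1 := by
    have : (1 : ℝ) ≤ n := by exact_mod_cast hn
    linarith
  have hw : ∀ {h : ℝ → ℝ}, IsBesselSolution n h →
      (∀ r, HasDerivAt h (deriv h r) r) ∧ (∀ r, HasDerivAt (deriv h) (deriv (deriv h) r) r) := by
    intro h hh
    have h1 : ContDiff ℝ (1 + 1) h := by
      have := hh.contDiff
      rwa [show (2 : WithTop ℕ∞) = 1 + 1 by norm_num] at this
    rw [contDiff_succ_iff_deriv] at h1
    exact ⟨fun r => (h1.1 r).hasDerivAt,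
      fun r => ((h1.2.2.differentiable one_ne_zero) r).hasDerivAt⟩
  set w : ℝ → ℝ := fun r => f r - g r
  set w1 : ℝ → ℝ := fun r => deriv f r - deriv g r
  set w2 : ℝ → ℝ := fun r => deriv (deriv f) r - deriv (deriv g) r
  have dw : ∀ r, HasDerivAt w (w1 r) r := fun r => ((hw hf).1 r).sub ((hw hg).1 r)
  have dw1 : ∀ r, HasDerivAt w1 (w2 r) r := fun r => ((hw hf).2 r).sub ((hw hg).2 r)
  set e : ℝ → ℝ := fun r => w1 r ^ 2 + w r ^ 2 with he
  have de : ∀ r, HasDerivAt e (2 * w1 r * (w2 r + w r)) r := fun r => by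
    have := ((dw1 r).pow 2).add ((dw r).pow 2)
    exact this.congr_deriv (by push_cast; ring)
  have e0 : e 0 = 0 := by simp [he, w, w1, hf.map_zero, hg.map_zero, hf.deriv_zero, hg.deriv_zero]
  have ode : ∀ r, r ≠ 0 → 2 * w1 r * (w2 r + w r) = -(2 * ((n : ℝ) - 1) * w1 r ^ 2 / r) := by
    intro r hr
    have h1 := hf.ode r hr
    have h2 := hg.ode r hr
    have h3 : w2 r + w r = -(((n : ℝ) - 1) * (w1 r / r)) := by
      simp only [w, w1, w2]; rw [sub_div]; linear_combination h1 - h2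
    rw [h3]; ring
  have ce : Continuous e := Differentiable.continuous fun r => (de r).differentiableAt
  have hle : ∀ r, e r ≤ 0 := by
    intro r
    rcases le_total 0 r with hr | hr
    · have : AntitoneOn e (Set.Ici 0) := by
        apply antitoneOn_of_deriv_nonpos (convex_Ici 0) ce.continuousOn
          (fun r _ => (de r).differentiableAt.differentiableWithinAt)
        intro x hx
        rw [interior_Ici] at hx
        have hx' : 0 < x := hx
        rw [(de x).deriv, ode x hx'.ne', neg_nonpos]
        positivity
      have := this (Set.mem_Ici.2 le_rfl) (Set.mem_Ici.2 hr) hr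
      linarith
    · have : MonotoneOn e (Set.Iic 0) := by
        apply monotoneOn_of_deriv_nonneg (convex_Iic 0) ce.continuousOn
          (fun r _ => (de r).differentiableAt.differentiableWithinAt)
        intro x hx
        rw [interior_Iic] at hx
        have hx' : x < 0 := hx
        rw [(de x).deriv, ode x hx'.ne, neg_nonneg]
        exact div_nonpos_of_nonneg_of_nonpos (by positivity) hx'.le
      have := this (Set.mem_Iic.2 hr) (Set.mem_Iic.2 le_rfl) hr
      linarith
  funext r
  have h : w r ^ 2 ≤ 0 := by have := hle r; simp only [he] at this; nlinarith [sq_nonneg (w1 r)]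
  have h' : w r = 0 := by simpa using le_antisymm h (sq_nonneg _)
  simpa [w, sub_eq_zero] using h'

/-- For `n ≥ 1`, `φ_n` is the unique solution of the Bessel initial value problem. -/
theorem isBesselSolution_iff {n : ℕ} (hn : 1 ≤ n) (f : ℝ → ℝ) :
    IsBesselSolution n f ↔ f = besselPhi n :=
  ⟨fun h => h.unique hn (isBesselSolution_besselPhi hn),
    fun h => h ▸ isBesselSolution_besselPhi hn⟩

/-- Euclidean space `ℝ^q`. -/
abbrev EucSpace (q : ℕ) : Type := EuclideanSpace ℝ (Fin q)

/-- Complex-valued alternating `k`-forms on `ℝ^q`: the values of differential `k`-forms. -/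
abbrev KForm (q k : ℕ) : Type := EucSpace q [⋀^Fin k]→L[ℝ] ℂ

/-- The codifferential `d* = -∑ᵢ ι_{eᵢ} ∂_{eᵢ}` of flat space, the formal adjoint of the exterior
derivative `extDeriv`. -/
noncomputable def codiff {q k : ℕ} (f : EucSpace q → KForm q (k + 1)) (x : EucSpace q) :
    KForm q k :=
  -∑ i : Fin q, (fderiv ℝ f x (EuclideanSpace.basisFun (Fin q) ℝ i)).curryLeft
    (EuclideanSpace.basisFun (Fin q) ℝ i)

/-- The Dirac operator `D = d + d*` on forms of mixed degree, given by their homogeneous parts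
(the parts of degree `k > q` vanish). -/
noncomputable def dirac {q : ℕ} (f : ∀ k : ℕ, EucSpace q → KForm q k) :
    ∀ k : ℕ, EucSpace q → KForm q k
  | 0 => codiff (f 1)
  | k + 1 => extDeriv (f k) + codiff (f (k + 2))

noncomputable def traceCLM {E G H ι : Type*} [NormedAddCommGroup E] [NormedSpace ℝ E]
    [NormedAddCommGroup G] [NormedSpace ℝ G] [NormedAddCommGroup H] [NormedSpace ℝ H] [Fintype ι]
    (e : ι → E) (c : G →L[ℝ] (E →L[ℝ] H)) : (E →L[ℝ] G) →L[ℝ] H :=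
  -∑ i, (ContinuousLinearMap.apply ℝ H (e i)) ∘L c ∘L (ContinuousLinearMap.apply ℝ G (e i))

theorem traceCLM_apply {E G H ι : Type*} [NormedAddCommGroup E] [NormedSpace ℝ E]
    [NormedAddCommGroup G] [NormedSpace ℝ G] [NormedAddCommGroup H] [NormedSpace ℝ H] [Fintype ι]
    (e : ι → E) (c : G →L[ℝ] (E →L[ℝ] H)) (B : E →L[ℝ] G) :
    traceCLM e c B = -∑ i, c (B (e i)) (e i) := by
  simp [traceCLM]

noncomputable def codiffCLM (q k : ℕ) : (EucSpace q →L[ℝ] KForm q (k + 1)) →L[ℝ] KForm q k :=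
  traceCLM (EuclideanSpace.basisFun (Fin q) ℝ)
    (ContinuousAlternatingMap.curryLeftLI (𝕜 := ℝ) (E := EucSpace q) (F := ℂ)
      (n := k)).toContinuousLinearMap

theorem codiffCLM_apply {q k : ℕ} (B : EucSpace q →L[ℝ] KForm q (k + 1)) :
    codiffCLM q k B = -∑ i : Fin q, (B (EuclideanSpace.basisFun (Fin q) ℝ i)).curryLeft
      (EuclideanSpace.basisFun (Fin q) ℝ i) :=
  traceCLM_apply _ _ B

theorem codiff_eq {q k : ℕ} (f : EucSpace q → KForm q (k + 1)) :
    codiff f = fun x => codiffCLM q k (fderiv ℝ f x) := by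
  funext x; rw [codiffCLM_apply]; rfl

theorem extDeriv_eq_clm {q k : ℕ} (f : EucSpace q → KForm q k) :
    extDeriv f = fun x => ContinuousAlternatingMap.alternatizeUncurryFinCLM ℝ (EucSpace q) ℂ
      (fderiv ℝ f x) := rfl

theorem fderiv_clm_fderiv {E G F : Type*} [NormedAddCommGroup E] [NormedSpace ℝ E]
    [NormedAddCommGroup G] [NormedSpace ℝ G] [NormedAddCommGroup F] [NormedSpace ℝ F]
    {f : E → G} (hf : ContDiff ℝ 2 f) (T : (E →L[ℝ] G) →L[ℝ] F) (x : E) :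
    HasFDerivAt (fun y => T (fderiv ℝ f y)) (T ∘L fderiv ℝ (fderiv ℝ f) x) x := by
  have h : DifferentiableAt ℝ (fderiv ℝ f) x :=
    ((hf.fderiv_right (m := 1) (by norm_num)).differentiable one_ne_zero) x
  exact T.hasFDerivAt.comp x h.hasFDerivAt

theorem fderiv_codiff {q k : ℕ} {f : EucSpace q → KForm q (k + 1)} (hf : ContDiff ℝ 2 f)
    (x : EucSpace q) :
    HasFDerivAt (codiff f) (codiffCLM q k ∘L fderiv ℝ (fderiv ℝ f) x) x := by
  rw [codiff_eq]
  exact fderiv_clm_fderiv hf _ x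

theorem fderiv_extDeriv {q k : ℕ} {f : EucSpace q → KForm q k} (hf : ContDiff ℝ 2 f)
    (x : EucSpace q) :
    HasFDerivAt (extDeriv f)
      (ContinuousAlternatingMap.alternatizeUncurryFinCLM ℝ (EucSpace q) ℂ ∘L
        fderiv ℝ (fderiv ℝ f) x) x := by
  rw [extDeriv_eq_clm]
  exact fderiv_clm_fderiv hf _ x

theorem fderiv_fderiv_comm {q k : ℕ} {f : EucSpace q → KForm q k} (hf : ContDiff ℝ 2 f)
    (x u v : EucSpace q) :
    fderiv ℝ (fderiv ℝ f) x u v = fderiv ℝ (fderiv ℝ f) x v u :=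
  (hf.contDiffAt (x := x)).isSymmSndFDerivAt (by simp) u v

theorem codiff_codiff {q k : ℕ} {f : EucSpace q → KForm q (k + 2)} (hf : ContDiff ℝ 2 f) :
    codiff (codiff f) = 0 := by
  funext x
  rw [codiff, (fderiv_codiff hf x).fderiv]
  simp only [ContinuousLinearMap.comp_apply, codiffCLM_apply]
  ext v
  simp only [ContinuousAlternatingMap.neg_apply, ContinuousAlternatingMap.sum_apply,
    ContinuousAlternatingMap.curryLeft_apply_apply, Pi.zero_apply,
    ContinuousAlternatingMap.coe_zero, Finset.sum_neg_distrib, neg_neg]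
  set e := EuclideanSpace.basisFun (Fin q) ℝ
  change ∑ a, ∑ i, fderiv ℝ (fderiv ℝ f) x (e a) (e i) (Matrix.vecCons (e i) (Matrix.vecCons (e a) v)) = 0
  have key : ∀ S : ℂ, S = -S → S = 0 := fun S h => by
    have : (2 : ℂ) * S = 0 := by linear_combination h
    simpa using this
  apply key
  nth_rewrite 1 [Finset.sum_comm]
  rw [← Finset.sum_neg_distrib]
  refine Finset.sum_congr rfl fun i _ => ?_
  rw [← Finset.sum_neg_distrib]
  refine Finset.sum_congr rfl fun j _ => ?_
  rw [fderiv_fderiv_comm hf]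
  have h := (fderiv ℝ (fderiv ℝ f) x (e i) (e j)).toAlternatingMap.map_swap
    (Matrix.vecCons (e j) (Matrix.vecCons (e i) v)) (i := 0) (j := 1) (by simp)
  simp only [ContinuousAlternatingMap.coe_toAlternatingMap] at h
  rw [← h]
  congr 1
  funext m
  refine Fin.cases ?_ (fun m => ?_) m
  · simp
  · refine Fin.cases ?_ (fun m => ?_) m
    · simp
    · have h0 : (m.succ.succ) ≠ 0 := Fin.succ_ne_zero _
      have h1 : (m.succ.succ) ≠ 1 := by
        rw [← Fin.succ_zero_eq_one]; exact fun h => Fin.succ_ne_zero _ (Fin.succ_injective _ h)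
      simp [Equiv.swap_apply_of_ne_of_ne h0 h1]

theorem curryLeft_alternatizeUncurryFin_succ {q k : ℕ}
    (B : EucSpace q →L[ℝ] KForm q (k + 1)) (e : EucSpace q) (v : Fin (k + 1) → EucSpace q) :
    (ContinuousAlternatingMap.alternatizeUncurryFin B).curryLeft e v =
      B e v - ∑ i : Fin (k + 1), (-1) ^ (i : ℕ) • (B (v i)).curryLeft e (i.removeNth v) := by
  rw [ContinuousAlternatingMap.curryLeft_apply_apply,
    ContinuousAlternatingMap.alternatizeUncurryFin_apply, Fin.sum_univ_succ, sub_eq_add_neg,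
    ← Finset.sum_neg_distrib]
  congr 1
  · simp
  · refine Finset.sum_congr rfl fun i _ => ?_
    have : i.succ.removeNth (Matrix.vecCons e v) = Matrix.vecCons e (i.removeNth v) := by
      funext m
      refine Fin.cases ?_ (fun m => ?_) m
      · simp [Fin.removeNth]
      · simp [Fin.removeNth]
    rw [this]
    simp [pow_succ]

theorem laplacian_apply_eq {q k : ℕ} (f : EucSpace q → KForm q k) (x : EucSpace q) :
    (Δ f) x = ∑ i : Fin q, fderiv ℝ (fderiv ℝ f) x (EuclideanSpace.basisFun (Fin q) ℝ i)
      (EuclideanSpace.basisFun (Fin q) ℝ i) := by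
  rw [InnerProductSpace.laplacian_eq_iteratedFDeriv_orthonormalBasis f
    (EuclideanSpace.basisFun (Fin q) ℝ)]
  simp [iteratedFDeriv_two_apply]

theorem codiff_extDeriv_zero {q : ℕ} {f : EucSpace q → KForm q 0} (hf : ContDiff ℝ 2 f) :
    codiff (extDeriv f) = -Δ f := by
  funext x
  rw [codiff, (fderiv_extDeriv hf x).fderiv, Pi.neg_apply, laplacian_apply_eq]
  simp only [ContinuousLinearMap.comp_apply]
  congr 1
  refine Finset.sum_congr rfl fun i _ => ?_
  ext v
  simp [ContinuousAlternatingMap.alternatizeUncurryFin_apply,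
    ContinuousAlternatingMap.alternatizeUncurryFinCLM_apply]

theorem hodge_succ {q k : ℕ} {f : EucSpace q → KForm q (k + 1)} (hf : ContDiff ℝ 2 f) :
    extDeriv (codiff f) + codiff (extDeriv f) = -Δ f := by
  funext x
  rw [Pi.add_apply, codiff, (fderiv_extDeriv hf x).fderiv, Pi.neg_apply, laplacian_apply_eq,
    extDeriv, (fderiv_codiff hf x).fderiv]
  simp only [ContinuousLinearMap.comp_apply,
    ContinuousAlternatingMap.alternatizeUncurryFinCLM_apply]
  ext v
  simp only [ContinuousAlternatingMap.add_apply, ContinuousAlternatingMap.neg_apply,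
    ContinuousAlternatingMap.sum_apply, curryLeft_alternatizeUncurryFin_succ,
    Finset.sum_sub_distrib]
  rw [ContinuousAlternatingMap.alternatizeUncurryFin_apply]
  simp only [ContinuousLinearMap.comp_apply, codiffCLM_apply, ContinuousAlternatingMap.neg_apply,
    ContinuousAlternatingMap.sum_apply, smul_neg, Finset.smul_sum, Finset.sum_neg_distrib]
  rw [Finset.sum_comm]
  simp only [fderiv_fderiv_comm hf x (v _)]
  ring

/-- `D²`, the Hodge Laplacian, acts as `-Δ` in each degree. -/
theorem dirac_dirac {q : ℕ} {f : ∀ k : ℕ, EucSpace q → KForm q k}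
    (hf : ∀ k, ContDiff ℝ 2 (f k)) (k : ℕ) : dirac (dirac f) k = -Δ (f k) := by
  have dext : ∀ k, Differentiable ℝ (extDeriv (f k)) := fun k x =>
    (fderiv_extDeriv (hf k) x).differentiableAt
  have dco : ∀ k, Differentiable ℝ (codiff (f (k + 1))) := fun k x =>
    (fderiv_codiff (hf (k + 1)) x).differentiableAt
  have codiff_add : ∀ {k : ℕ} {g h : EucSpace q → KForm q (k + 1)}, Differentiable ℝ g →
      Differentiable ℝ h → codiff (g + h) = codiff g + codiff h := by
    intro k g h hg hh
    funext x
    simp only [codiff_eq, Pi.add_apply, fderiv_add (hg x) (hh x), map_add]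
  have ext_add : ∀ {k : ℕ} {g h : EucSpace q → KForm q k}, Differentiable ℝ g →
      Differentiable ℝ h → extDeriv (g + h) = extDeriv g + extDeriv h := by
    intro k g h hg hh
    funext x
    exact extDeriv_add (hg x) (hh x)
  have ext_ext : ∀ k, extDeriv (extDeriv (f k)) = 0 := fun k =>
    extDeriv_extDeriv (hf k) (by simp)
  match k with
  | 0 =>
    change codiff (extDeriv (f 0) + codiff (f 2)) = _
    rw [codiff_add (dext 0) (dco 1), codiff_codiff (hf 2), add_zero, codiff_extDeriv_zero (hf 0)]
  | 1 =>
    change extDeriv (codiff (f 1)) + codiff (extDeriv (f 1) + codiff (f 3)) = _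
    rw [codiff_add (dext 1) (dco 2), codiff_codiff (hf 3), add_zero, hodge_succ (hf 1)]
  | k + 2 =>
    change extDeriv (extDeriv (f k) + codiff (f (k + 2))) +
      codiff (extDeriv (f (k + 2)) + codiff (f (k + 4))) = _
    rw [codiff_add (dext _) (dco _), codiff_codiff (hf (k + 4)), add_zero,
      ext_add (dext _) (dco _), ext_ext, zero_add, hodge_succ (hf (k + 2))]

/-- Smooth compactly supported forms. -/
def IsTestForm {q k : ℕ} (f : EucSpace q → KForm q k) : Prop :=
  ContDiff ℝ ∞ f ∧ HasCompactSupport f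

/-- The Fourier transform turns `D²` into multiplication by `(2π‖ξ‖)²`. -/
theorem fourier_dirac_dirac {q : ℕ} {f : ∀ k : ℕ, EucSpace q → KForm q k}
    (hf : ∀ k, IsTestForm (f k)) (k : ℕ) (ξ : EucSpace q) :
    𝓕 (dirac (dirac f) k) ξ = (((2 * Real.pi * ‖ξ‖) ^ 2 : ℝ) : ℂ) • 𝓕 (f k) ξ := by
  rw [dirac_dirac (fun k => (hf k).1.of_le (by norm_cast))]
  let g := (hf k).2.toSchwartzMap (hf k).1
  have hg : (g : EucSpace q → KForm q k) = f k := by funext x; simp [g]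
  have h1 : ((-Δ g : SchwartzMap (EucSpace q) (KForm q k)) : EucSpace q → KForm q k) =
      -Δ (f k) := by
    rw [← hg]; funext x
    simp [SchwartzMap.laplacian_apply]
  rw [← h1, ← hg, ← SchwartzMap.fourier_coe, ← SchwartzMap.fourier_coe,
    SchwartzMap.laplacian_eq_fourierMultiplierCLM g, SchwartzMap.fourierMultiplierCLM_apply]
  have h2 : 𝓕 (-(-(2 * Real.pi) ^ 2 • 𝓕⁻ (SchwartzMap.smulLeftCLM (KForm q k)
      (fun x : EucSpace q => ‖x‖ ^ 2) (𝓕 g)))) = (2 * Real.pi) ^ 2 •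
        (SchwartzMap.smulLeftCLM (KForm q k) (fun x : EucSpace q => ‖x‖ ^ 2) (𝓕 g)) := by
    rw [neg_smul, neg_neg, FourierTransform.fourier_smul, FourierTransform.fourier_fourierInv_eq]
  rw [h2, smul_apply, SchwartzMap.smulLeftCLM_apply_apply (by fun_prop)]
  ext v
  simp
  ring

/-- The functional calculus `φ(tD)` for an even function `φ`, on smooth compactly supported forms.
An even function of `D` is a function of `D²`, which preserves degrees and which the Fourier
transform diagonalises as `(2π‖ξ‖)²` (`fourier_dirac_dirac`); hence `φ(tD)` is multiplication by
`φ(t · 2π‖ξ‖)` on the Fourier side. -/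
noncomputable def evenDiracCalculus {q k : ℕ} (φ : ℝ → ℝ) (t : ℝ) (g : EucSpace q → KForm q k) :
    EucSpace q → KForm q k :=
  𝓕⁻ (fun ξ : EucSpace q => ((φ (t * (2 * Real.pi * ‖ξ‖)) : ℝ) : ℂ) • 𝓕 g ξ)

/-- The deformed exterior derivative `d_t = t φ_{q+2}(tD) d` on smooth compactly supported forms. -/
noncomputable def deformedExtDeriv {q k : ℕ} (t : ℝ) (f : EucSpace q → KForm q k) :
    EucSpace q → KForm q (k + 1) :=
  fun x => t • evenDiracCalculus (besselPhi (q + 2)) t (extDeriv f) x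

/-- `u` represents the value at `f ∈ L²` of the closure in `L²` of the operator `T`, which is given
on smooth compactly supported forms. For an operator that is bounded in the `L²` norm this is its
extension to the whole Hilbert space. -/
def IsL2Extension {q k l : ℕ} (T : (EucSpace q → KForm q k) → (EucSpace q → KForm q l))
    (f : EucSpace q → KForm q k) (u : EucSpace q → KForm q l) : Prop :=
  MemLp f 2 volume ∧ MemLp u 2 volume ∧
    ∃ g : ℕ → EucSpace q → KForm q k, (∀ j, IsTestForm (g j)) ∧
      Tendsto (fun j => eLpNorm (g j - f) 2 volume) atTop (𝓝 0) ∧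
      Tendsto (fun j => eLpNorm (T (g j) - u) 2 volume) atTop (𝓝 0)

/-!
Let `σ` be the rotation invariant probability measure on the unit sphere of an `n`-dimensional
Euclidean space. Its characteristic function is radial and satisfies `Δ χ = -χ`, because `‖θ‖ = 1`
on the sphere; restricted to a ray it therefore solves the Bessel equation, so `χ ξ = φ_n ‖ξ‖`. By
Fourier inversion `φ_n(tD)` is the mean over spheres of radius `t`. Since `φ_n` has derivative
`-(r / n) φ_{n+2} r`, differentiating `χ` gives `∫ e^{i⟨θ, ξ⟩} θ dσ(θ) = (i / n) φ_{n+2} ‖ξ‖ ξ`, so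
that `t φ_{n+2}(tD) d` is the spherical mean weighted by `n θ ∧ ·`: the derivative has disappeared.
Both means preserve continuity and are bounded on `L²`, hence they compute the closures. For
`φ_n(tD) d` it remains to see that two `C¹` forms with the same values and normal derivatives on a
sphere have the same exterior derivative there, which holds because the values on the sphere
determine the tangential derivatives.
-/

theorem hasDerivAt_cos_smul_add_sin_smul {E : Type*} [NormedAddCommGroup E] [NormedSpace ℝ E]
    (x v : E) (s : ℝ) :
    HasDerivAt (fun s => Real.cos s • x + Real.sin s • v) (Real.cos s • v + Real.sin s • -x) s :=
  (((Real.hasDerivAt_cos s).smul_const x).add ((Real.hasDerivAt_sin s).smul_const v)).congr_deriv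
    (by module)

section GreatCircle

variable {E : Type*} [NormedAddCommGroup E] [InnerProductSpace ℝ E]
  {F : Type*} [NormedAddCommGroup F] [NormedSpace ℝ F]

theorem norm_cos_smul_add_sin_smul {x v : E} (hxv : inner ℝ x v = 0) (hv : ‖v‖ = ‖x‖) (s : ℝ) :
    ‖Real.cos s • x + Real.sin s • v‖ = ‖x‖ := by
  rw [← sq_eq_sq₀ (norm_nonneg _) (norm_nonneg _), norm_add_sq_real, real_inner_smul_left,
    real_inner_smul_right, hxv, norm_smul, norm_smul, hv, mul_pow, mul_pow, Real.norm_eq_abs,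
    Real.norm_eq_abs, sq_abs, sq_abs]
  linear_combination ‖x‖ ^ 2 * Real.sin_sq_add_cos_sq s

theorem fderiv_apply_eq_of_eqOn_sphere {f g : E → F} {p x : E} {t : ℝ} (ht : t ≠ 0)
    (hf : DifferentiableAt ℝ f x) (hg : DifferentiableAt ℝ g x) (hx : x ∈ Metric.sphere p t)
    (hfg : Set.EqOn f g (Metric.sphere p t)) {v : E} (hv : inner ℝ (x - p) v = 0) :
    fderiv ℝ f x v = fderiv ℝ g x v := by
  rcases eq_or_ne v 0 with rfl | hv0
  · rw [map_zero, map_zero]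
  have hnorm : ‖x - p‖ = t := mem_sphere_iff_norm.1 hx
  set w := (t / ‖v‖) • v
  have hw : inner ℝ (x - p) w = 0 := by rw [real_inner_smul_right, hv, mul_zero]
  have norm_w : ‖w‖ = ‖x - p‖ := by
    rw [norm_smul, norm_div, norm_norm, div_mul_cancel₀ _ (norm_ne_zero_iff.2 hv0), ← hnorm,
      norm_norm]
  let γ (s : ℝ) : E := p + (Real.cos s • (x - p) + Real.sin s • w)
  have hγ : HasDerivAt γ w 0 := by
    simpa [γ] using (hasDerivAt_cos_smul_add_sin_smul (x - p) w 0).const_add p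
  have γ_zero : x = γ 0 := by simp [γ]
  have hγ_sphere (s : ℝ) : γ s ∈ Metric.sphere p t := by
    rw [mem_sphere_iff_norm, add_sub_cancel_left, norm_cos_smul_add_sin_smul hw norm_w, hnorm]
  have comp_eq : f ∘ γ = g ∘ γ := funext fun s => hfg (hγ_sphere s)
  have deriv_f := hf.hasFDerivAt.comp_hasDerivAt_of_eq 0 hγ γ_zero
  have deriv_g := hg.hasFDerivAt.comp_hasDerivAt_of_eq 0 hγ γ_zero
  have h := deriv_f.unique (comp_eq ▸ deriv_g)
  rw [map_smul, map_smul] at h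
  exact smul_right_injective F (div_ne_zero ht (norm_ne_zero_iff.2 hv0)) h

theorem fderiv_eq_of_eqOn_sphere {f g : E → F} {p x : E} {t : ℝ} (ht : t ≠ 0)
    (hf : DifferentiableAt ℝ f x) (hg : DifferentiableAt ℝ g x) (hx : x ∈ Metric.sphere p t)
    (hfg : Set.EqOn f g (Metric.sphere p t))
    (hnormal : fderiv ℝ f x (x - p) = fderiv ℝ g x (x - p)) : fderiv ℝ f x = fderiv ℝ g x := by
  ext v
  obtain ⟨y, hy, w, hw, rfl⟩ := (ℝ ∙ (x - p)).exists_add_mem_mem_orthogonal v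
  obtain ⟨c, rfl⟩ := Submodule.mem_span_singleton.1 hy
  rw [map_add, map_add, map_smul, map_smul, hnormal, fderiv_apply_eq_of_eqOn_sphere ht hf hg hx hfg
    (Submodule.mem_orthogonal_singleton_iff_inner_right.1 hw)]

end GreatCircle

section Radial

variable {E : Type*} [NormedAddCommGroup E] [InnerProductSpace ℝ E]
  {F : Type*} [NormedAddCommGroup F] [NormedSpace ℝ F]

/-- Along the great circle through `x` and `v` a radial function is constant, so its second
derivative there vanishes. -/
theorem fderiv_fderiv_apply_of_radial {f : E → F} (hf : ContDiff ℝ 2 f)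
    (hrad : ∀ x y, ‖x‖ = ‖y‖ → f x = f y) {x v : E} (hxv : inner ℝ x v = 0) (hv : ‖v‖ = ‖x‖) :
    fderiv ℝ (fderiv ℝ f) x v v = fderiv ℝ f x x := by
  have hf₁ : Differentiable ℝ f := hf.differentiable two_ne_zero
  have hf₂ : Differentiable ℝ (fderiv ℝ f) :=
    (hf.fderiv_right (m := 1) le_rfl).differentiable one_ne_zero
  have tangent_eq_zero (s : ℝ) :
      fderiv ℝ f (Real.cos s • x + Real.sin s • v) (Real.cos s • v + Real.sin s • -x) = 0 := by
    have h := (hf₁ _).hasFDerivAt.comp_hasDerivAt s (hasDerivAt_cos_smul_add_sin_smul x v s)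
    refine h.unique ((hasDerivAt_const s (f x)).congr_of_eventuallyEq (.of_forall fun r => ?_))
    exact hrad _ _ (norm_cos_smul_add_sin_smul hxv hv r)
  have h := ((hf₂ _).hasFDerivAt.comp_hasDerivAt 0
    (hasDerivAt_cos_smul_add_sin_smul x v 0)).clm_apply (hasDerivAt_cos_smul_add_sin_smul v (-x) 0)
  have h0 := h.unique ((hasDerivAt_const 0 (0 : F)).congr_of_eventuallyEq
    (.of_forall tangent_eq_zero))
  simpa [← sub_eq_add_neg, sub_eq_zero] using h0

theorem laplacian_smul_of_radial [FiniteDimensional ℝ E] {ι : Type*} [Fintype ι]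
    (b : OrthonormalBasis ι ℝ E) {f : E → F} (hf : ContDiff ℝ 2 f)
    (hrad : ∀ x y, ‖x‖ = ‖y‖ → f x = f y) (i : ι) {r : ℝ} (hr : r ≠ 0) :
    (Δ f) (r • b i) = deriv (deriv fun s : ℝ => f (s • b i)) r +
      ((Fintype.card ι : ℝ) - 1) • r⁻¹ • deriv (fun s : ℝ => f (s • b i)) r := by
  classical
  have hray (s : ℝ) : HasDerivAt (fun s : ℝ => s • b i) (b i) s := by
    simpa using (hasDerivAt_id s).smul_const (b i)
  have deriv_ray : deriv (fun s : ℝ => f (s • b i)) = fun s => fderiv ℝ f (s • b i) (b i) :=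
    funext fun s => ((hf.differentiable two_ne_zero _).hasFDerivAt.comp_hasDerivAt s
      (hray s)).deriv
  have deriv_deriv_ray : deriv (fun s : ℝ => fderiv ℝ f (s • b i) (b i)) r =
      fderiv ℝ (fderiv ℝ f) (r • b i) (b i) (b i) := by
    have hf₂ := (hf.fderiv_right (m := 1) le_rfl).differentiable one_ne_zero
    simpa using (((hf₂ _).hasFDerivAt.comp_hasDerivAt r (hray r)).clm_apply
      (hasDerivAt_const r (b i))).deriv
  have tangential (j : ι) (hj : j ≠ i) : fderiv ℝ (fderiv ℝ f) (r • b i) (b j) (b j) =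
      r⁻¹ • fderiv ℝ f (r • b i) (b i) := by
    have h := fderiv_fderiv_apply_of_radial hf hrad (x := r • b i) (v := r • b j)
      (by simp [real_inner_smul_left, real_inner_smul_right, b.inner_eq_zero hj.symm])
      (by simp [norm_smul])
    simp only [map_smul, smul_apply] at h
    rw [eq_inv_smul_iff₀ hr]
    exact smul_right_injective F hr h
  rw [InnerProductSpace.laplacian_eq_iteratedFDeriv_orthonormalBasis f b, deriv_ray,
    deriv_deriv_ray]
  simp only [iteratedFDeriv_two_apply, Matrix.cons_val_zero, Matrix.cons_val_one]
  rw [← Finset.add_sum_erase _ _ (Finset.mem_univ i),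
    Finset.sum_congr rfl fun j hj => tangential j (Finset.ne_of_mem_erase hj), Finset.sum_const,
    Finset.card_erase_of_mem (Finset.mem_univ i), Finset.card_univ,
    ← Nat.cast_smul_eq_nsmul ℝ, Nat.cast_sub (Fintype.card_pos_iff.2 ⟨i⟩), Nat.cast_one]

end Radial

section SphereMeasure

variable (E : Type*) [NormedAddCommGroup E] [InnerProductSpace ℝ E] [FiniteDimensional ℝ E]
  [MeasurableSpace E] [BorelSpace E]

/-- The rotation invariant probability measure on the unit sphere of `E`, encoded as a measure on
the ambient space `E`: the image of the uniform measure on the unit ball under radial projection. -/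
noncomputable def sphereMeasure : Measure E :=
  (ProbabilityTheory.cond volume (Metric.ball (0 : E) 1)).map fun x => ‖x‖⁻¹ • x

theorem measurable_radialProjection : Measurable fun x : E => ‖x‖⁻¹ • x := by fun_prop

instance isProbabilityMeasure_sphereMeasure : IsProbabilityMeasure (sphereMeasure E) :=
  have := ProbabilityTheory.cond_isProbabilityMeasure_of_finite
    (Metric.measure_ball_pos volume (0 : E) one_pos).ne' measure_ball_lt_top.ne
  Measure.isProbabilityMeasure_map (measurable_radialProjection E).aemeasurable

theorem ae_sphereMeasure_norm_eq_one [Nontrivial E] : ∀ᵐ θ ∂sphereMeasure E, ‖θ‖ = 1 := by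
  rw [sphereMeasure, ae_map_iff (measurable_radialProjection E).aemeasurable
    (measurableSet_eq_fun measurable_norm measurable_const)]
  filter_upwards [ProbabilityTheory.cond_absolutelyContinuous.ae_le (Measure.ae_ne volume (0 : E))]
    with x hx
  simpa using norm_smul_inv_norm (𝕜 := ℝ) hx

variable {E}

theorem measurePreserving_sphereMeasure (U : E ≃ₗᵢ[ℝ] E) :
    MeasurePreserving U (sphereMeasure E) (sphereMeasure E) := by
  have map_cond_ball : (ProbabilityTheory.cond volume (Metric.ball (0 : E) 1)).map U =
      ProbabilityTheory.cond volume (Metric.ball (0 : E) 1) := by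
    have h := (U.measurePreserving.restrict_preimage_emb U.toMeasurableEquiv.measurableEmbedding
      (Metric.ball (0 : E) 1)).map_eq
    rw [U.preimage_ball, map_zero] at h
    rw [ProbabilityTheory.cond, Measure.map_smul, h]
  refine ⟨U.continuous.measurable, ?_⟩
  rw [sphereMeasure, Measure.map_map U.continuous.measurable (measurable_radialProjection E)]
  conv_rhs => rw [← map_cond_ball,
    Measure.map_map (measurable_radialProjection E) U.continuous.measurable]
  congr 1
  funext x
  simp only [Function.comp_apply, map_smul, LinearIsometryEquiv.norm_map]

theorem restrict_sphere_sphereMeasure [Nontrivial E] :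
    (sphereMeasure E).restrict (Metric.sphere 0 1) = sphereMeasure E := by
  refine Measure.restrict_eq_self_of_ae_mem ?_
  filter_upwards [ae_sphereMeasure_norm_eq_one E] with θ hθ using mem_sphere_zero_iff_norm.2 hθ

theorem integrable_sphereMeasure_of_continuous [Nontrivial E] {F : Type*} [NormedAddCommGroup F]
    {f : E → F} (hf : Continuous f) : Integrable f (sphereMeasure E) := by
  rw [← restrict_sphere_sphereMeasure]
  exact hf.continuousOn.integrableOn_compact (isCompact_sphere 0 1)

theorem charFun_sphereMeasure_eq_of_norm_eq {ξ η : E} (h : ‖ξ‖ = ‖η‖) :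
    charFun (sphereMeasure E) ξ = charFun (sphereMeasure E) η := by
  set R := (ℝ ∙ (ξ - η))ᗮ.reflection
  have integral_comp := (measurePreserving_sphereMeasure R).integral_comp
    R.toMeasurableEquiv.measurableEmbedding fun θ => Complex.exp ((inner ℝ θ η : ℝ) * Complex.I)
  rw [charFun_apply, charFun_apply, ← integral_comp, ← Submodule.reflection_sub h]
  simp only [LinearIsometryEquiv.inner_map_map, R]

end SphereMeasure

theorem memLp_id_of_ae_norm_eq_one {E : Type*} [NormedAddCommGroup E] [MeasurableSpace E]
    [OpensMeasurableSpace E] [SecondCountableTopology E] {μ : Measure E} [IsFiniteMeasure μ]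
    (hμ : ∀ᵐ θ ∂μ, ‖θ‖ = 1) (p : ENNReal) : MemLp id p μ :=
  .of_bound aestronglyMeasurable_id 1 (hμ.mono fun _ h => h.le)

section Helmholtz

variable {E : Type*} [NormedAddCommGroup E] [InnerProductSpace ℝ E] [FiniteDimensional ℝ E]
  [MeasurableSpace E] [BorelSpace E] {μ : Measure E} [IsFiniteMeasure μ]

theorem contDiff_charFun_of_ae_norm_eq_one (hμ : ∀ᵐ θ ∂μ, ‖θ‖ = 1) {n : ℕ∞} :
    ContDiff ℝ n (charFun μ) :=
  contDiff_charFun' fun k => memLp_id_of_ae_norm_eq_one hμ k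

theorem laplacian_charFun_of_ae_norm_eq_one (hμ : ∀ᵐ θ ∂μ, ‖θ‖ = 1) :
    Δ (charFun μ) = -charFun μ := by
  set b := stdOrthonormalBasis ℝ E
  funext ξ
  have hint (i) : Integrable (fun θ => ((inner ℝ θ (b i) : ℝ) : ℂ) ^ 2 *
      Complex.exp ((inner ℝ θ ξ : ℝ) * Complex.I)) μ := by
    refine .of_bound (Continuous.aestronglyMeasurable (by fun_prop)) 1 ?_
    filter_upwards [hμ] with θ hθ
    rw [norm_mul, Complex.norm_exp_ofReal_mul_I, mul_one, norm_pow, Complex.norm_real]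
    exact pow_le_one₀ (norm_nonneg _) (by simpa [hθ] using norm_inner_le_norm (𝕜 := ℝ) θ (b i))
  have sum_sq {θ : E} (hθ : ‖θ‖ = 1) : ∑ i, ((inner ℝ θ (b i) : ℝ) : ℂ) ^ 2 = 1 := by
    have h := b.sum_sq_inner_left θ
    rw [hθ, one_pow] at h
    exact_mod_cast h
  rw [InnerProductSpace.laplacian_eq_iteratedFDeriv_orthonormalBasis _ b]
  simp only [iteratedFDeriv_charFun (memLp_id_of_ae_norm_eq_one hμ _), Fin.prod_univ_two,
    Matrix.cons_val_zero, Matrix.cons_val_one, Complex.I_sq, neg_one_mul, Finset.sum_neg_distrib,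
    Pi.neg_apply, charFun_apply, neg_inj, ← sq, Complex.ofReal_pow]
  rw [← integral_finsetSum _ fun i _ => hint i]
  refine integral_congr_ae ?_
  filter_upwards [hμ] with θ hθ
  rw [← Finset.sum_mul, sum_sq hθ, one_mul]

end Helmholtz

section Bessel

variable {E : Type*} [NormedAddCommGroup E] [InnerProductSpace ℝ E] [FiniteDimensional ℝ E]

theorem isBesselSolution_smul_of_radial {f : E → ℝ} (hf : ContDiff ℝ 2 f)
    (hrad : ∀ x y, ‖x‖ = ‖y‖ → f x = f y) (hΔ : Δ f = -f) (h0 : f 0 = 1)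
    (i : Fin (Module.finrank ℝ E)) :
    IsBesselSolution (Module.finrank ℝ E) fun r : ℝ => f (r • stdOrthonormalBasis ℝ E i) where
  contDiff := hf.comp (contDiff_id.smul contDiff_const)
  ode r hr := by
    have h := laplacian_smul_of_radial (stdOrthonormalBasis ℝ E) hf hrad i hr
    rw [hΔ, Fintype.card_fin, smul_eq_mul, smul_eq_mul, Pi.neg_apply] at h
    linear_combination -h
  map_zero := by rw [zero_smul, h0]
  deriv_zero := by
    set h := fun r : ℝ => f (r • stdOrthonormalBasis ℝ E i)
    have even : (fun r => h (-r)) = h := funext fun r => hrad _ _ (by simp [norm_smul])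
    have deriv_neg := deriv_comp_neg h 0
    rw [even, neg_zero] at deriv_neg
    exact self_eq_neg.1 deriv_neg

theorem eq_besselPhi_norm_of_radial [Nontrivial E] {f : E → ℝ} (hf : ContDiff ℝ 2 f)
    (hrad : ∀ x y, ‖x‖ = ‖y‖ → f x = f y) (hΔ : Δ f = -f) (h0 : f 0 = 1) (x : E) :
    f x = besselPhi (Module.finrank ℝ E) ‖x‖ := by
  have hn : 1 ≤ Module.finrank ℝ E := Module.finrank_pos
  rw [← (isBesselSolution_iff hn _).1 (isBesselSolution_smul_of_radial hf hrad hΔ h0 ⟨0, hn⟩)]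
  exact hrad _ _ (by simp [norm_smul])

theorem charFun_sphereMeasure [Nontrivial E] [MeasurableSpace E] [BorelSpace E] (ξ : E) :
    charFun (sphereMeasure E) ξ = (besselPhi (Module.finrank ℝ E) ‖ξ‖ : ℝ) := by
  set χ := charFun (sphereMeasure E)
  have hχ : ContDiff ℝ 2 χ := contDiff_charFun_of_ae_norm_eq_one (ae_sphereMeasure_norm_eq_one E)
  have hrad (ξ η : E) (h : ‖ξ‖ = ‖η‖) : χ ξ = χ η := charFun_sphereMeasure_eq_of_norm_eq h
  have re_eq : ((χ ξ).re : ℂ) = χ ξ := by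
    rw [← Complex.conj_eq_iff_re, ← charFun_neg]
    exact hrad _ _ (norm_neg ξ)
  have laplacian_re : Δ (Complex.reCLM ∘ χ) = -(Complex.reCLM ∘ χ) := by
    funext η
    rw [hχ.contDiffAt.laplacian_CLM_comp_left,
      laplacian_charFun_of_ae_norm_eq_one (ae_sphereMeasure_norm_eq_one E)]
    exact Complex.neg_re _
  rw [← re_eq, ← eq_besselPhi_norm_of_radial (f := Complex.reCLM ∘ χ)
    (Complex.reCLM.contDiff.comp hχ) (fun _ _ h => congrArg Complex.re (hrad _ _ h)) laplacian_re
    (by simp [χ])]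
  rfl

end Bessel

theorem besselPhi_abs (n : ℕ) (r : ℝ) : besselPhi n |r| = besselPhi n r := by
  simp only [besselPhi, pow_mul, sq_abs]

theorem succ_mul_besselCoeff_succ {n : ℕ} (hn : 1 ≤ n) (k : ℕ) :
    ((k : ℝ) + 1) * besselCoeff n (k + 1) = -(2 * (n : ℝ))⁻¹ * besselCoeff (n + 2) k := by
  induction k with
  | zero => simp [besselCoeff]
  | succ k ih =>
    rw [besselCoeff_succ n (k + 1), besselCoeff_succ (n + 2) k,
      ← mul_assoc _ (besselCoeff (n + 2) k), ← ih]
    push_cast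
    field_simp
    ring

theorem hasFDerivAt_besselPhi_norm {E : Type*} [NormedAddCommGroup E] [InnerProductSpace ℝ E]
    {n : ℕ} (hn : 1 ≤ n) (ξ : E) :
    HasFDerivAt (fun ξ : E => besselPhi n ‖ξ‖)
      (-(besselPhi (n + 2) ‖ξ‖ / n) • innerSL ℝ ξ) ξ := by
  have besselPhi_eq (n : ℕ) (r : ℝ) : besselPhi n r = ∑' k, besselCoeff n k * (r ^ 2) ^ k := by
    simp only [besselPhi, pow_mul]
  have h := (hasDerivAt_powerSum (abs_besselCoeff_le hn) (‖ξ‖ ^ 2)).comp_hasFDerivAt ξ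
    (hasStrictFDerivAt_norm_sq ξ).hasFDerivAt
  simp only [succ_mul_besselCoeff_succ hn, mul_assoc, tsum_mul_left, ← besselPhi_eq] at h
  refine (h.congr_of_eventuallyEq (.of_forall fun η => besselPhi_eq n ‖η‖)).congr_fderiv ?_
  rw [← Nat.cast_smul_eq_nsmul ℝ, smul_smul]
  congr 1
  field_simp
  ring

theorem integral_inner_mul_exp_sphereMeasure {E : Type*} [NormedAddCommGroup E]
    [InnerProductSpace ℝ E] [FiniteDimensional ℝ E] [Nontrivial E] [MeasurableSpace E]
    [BorelSpace E] (ξ v : E) :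
    ∫ θ, (inner ℝ θ v : ℝ) * Complex.exp ((inner ℝ θ ξ : ℝ) * Complex.I) ∂sphereMeasure E =
      ((besselPhi (Module.finrank ℝ E + 2) ‖ξ‖ / Module.finrank ℝ E * inner ℝ ξ v : ℝ) : ℂ) *
        Complex.I := by
  have hderiv : fderiv ℝ (charFun (sphereMeasure E)) ξ v =
      ((-(besselPhi (Module.finrank ℝ E + 2) ‖ξ‖ / Module.finrank ℝ E) * inner ℝ ξ v : ℝ) : ℂ) := by
    have h := Complex.ofRealCLM.hasFDerivAt.comp ξ
      (hasFDerivAt_besselPhi_norm (Module.finrank_pos (R := ℝ) (M := E)) ξ)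
    rw [funext charFun_sphereMeasure]
    exact congrArg (· v) h.fderiv
  have h := iteratedFDeriv_charFun (t := ξ)
    (memLp_id_of_ae_norm_eq_one (ae_sphereMeasure_norm_eq_one E) (1 : ℕ)) fun _ => v
  rw [iteratedFDeriv_one_apply, hderiv] at h
  simp only [pow_one, Fin.prod_univ_one] at h
  rw [← mul_right_inj' Complex.I_ne_zero, ← h]
  push_cast
  linear_combination -(besselPhi (Module.finrank ℝ E + 2) ‖ξ‖ / Module.finrank ℝ E *
    (inner ℝ ξ v : ℝ) : ℂ) * Complex.I_sq

section FourierMultiplier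

variable {E : Type*} [NormedAddCommGroup E] [InnerProductSpace ℝ E] [FiniteDimensional ℝ E]
  [MeasurableSpace E] [BorelSpace E] {F G : Type*} [NormedAddCommGroup F] [NormedSpace ℂ F]
  [NormedAddCommGroup G] [NormedSpace ℂ G]

theorem fourier_clm_comp [CompleteSpace F] [CompleteSpace G] (A : F →L[ℝ] G)
    (hA : ∀ (c : ℂ) y, A (c • y) = c • A y) {f : E → F} (hf : Integrable f) (ξ : E) :
    𝓕 (fun x => A (f x)) ξ = A (𝓕 f ξ) := by
  simp only [Real.fourier_eq, Circle.smul_def, ← hA]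
  exact A.integral_comp_comm ((Real.fourierIntegral_convergent_iff ξ).2 hf)

theorem integral_exp_smul_fourier [CompleteSpace F] (g : SchwartzMap E F) (x : E) :
    ∫ ξ, Complex.exp (↑(2 * Real.pi * inner ℝ ξ x) * Complex.I) • (𝓕 g) ξ = g x := by
  rw [← Real.fourierInv_eq', ← SchwartzMap.fourierInv_coe, FourierTransform.fourierInv_fourier_eq]

theorem fourierInv_integral_exp_smul_fourier [CompleteSpace F] [CompleteSpace G] {μ : Measure E}
    [SFinite μ] {S : E → F →L[ℝ] G} (hS : Integrable S μ)
    (hSc : ∀ θ (c : ℂ) y, S θ (c • y) = c • S θ y) (g : SchwartzMap E F) (t : ℝ) (x : E) :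
    𝓕⁻ (fun ξ => ∫ θ, Complex.exp ((inner ℝ θ ((2 * Real.pi * t) • ξ) : ℝ) * Complex.I) •
      S θ (𝓕 (g : E → F) ξ) ∂μ) x = ∫ θ, S θ (g (x + t • θ)) ∂μ := by
  let e (θ ξ : E) : ℂ := Complex.exp (↑(2 * Real.pi * inner ℝ ξ (x + t • θ)) * Complex.I)
  have e_eq (θ ξ : E) : e θ ξ = Complex.exp (↑(2 * Real.pi * inner ℝ ξ x) * Complex.I) *
      Complex.exp ((inner ℝ θ ((2 * Real.pi * t) • ξ) : ℝ) * Complex.I) := by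
    simp only [e]
    rw [← Complex.exp_add, ← add_mul, ← Complex.ofReal_add, inner_add_right, real_inner_smul_right,
      real_inner_smul_right, real_inner_comm ξ θ]
    ring_nf
  have norm_e (θ ξ : E) : ‖e θ ξ‖ = 1 := Complex.norm_exp_ofReal_mul_I _
  have hint : Integrable (fun z : E × E => e z.1 z.2 • S z.1 ((𝓕 g) z.2)) (μ.prod volume) := by
    refine (hS.norm.mul_prod (𝓕 g).integrable.norm).mono' (.smul ?_ ?_) (ae_of_all _ fun z => ?_)
    · exact Continuous.aestronglyMeasurable (by fun_prop)
    · exact (ContinuousLinearMap.id ℝ (F →L[ℝ] G)).aestronglyMeasurable_comp₂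
        hS.aestronglyMeasurable.comp_fst (𝓕 g).continuous.aestronglyMeasurable.comp_snd
    · rw [norm_smul, norm_e, one_mul]
      exact (S z.1).le_opNorm _
  have fourier_inversion (θ : E) : S θ (g (x + t • θ)) = ∫ ξ, e θ ξ • S θ ((𝓕 g) ξ) := by
    simp only [← integral_exp_smul_fourier g (x + t • θ), ← hSc]
    refine ((S θ).integral_comp_comm ((𝓕 g).integrable.bdd_smul 1 ?_ ?_)).symm
    · exact Continuous.aestronglyMeasurable (by fun_prop)
    · exact ae_of_all _ fun ξ => (norm_e θ ξ).le
  simp only [fourier_inversion]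
  rw [integral_integral_swap hint, Real.fourierInv_eq', ← SchwartzMap.fourier_coe]
  simp only [← integral_smul, smul_smul, e_eq]

end FourierMultiplier

section GradSymbol

variable {E : Type*} [NormedAddCommGroup E] [InnerProductSpace ℝ E]
  {F : Type*} [NormedAddCommGroup F] {G : Type*} [NormedAddCommGroup G]

/-- The weight of the spherical mean that represents `t φ_{n+2}(t|∇|) A ∇`, where `n` is the
dimension of `E`, for a linear operation `A` on derivatives. -/
noncomputable def gradSymbol [NormedSpace ℝ F] [NormedSpace ℝ G] (A : (E →L[ℝ] F) →L[ℝ] G)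
    (θ : E) : F →L[ℝ] G :=
  (Module.finrank ℝ E : ℝ) • (A ∘L ContinuousLinearMap.smulRightL ℝ E F (innerSL ℝ θ))

theorem gradSymbol_apply [NormedSpace ℝ F] [NormedSpace ℝ G] (A : (E →L[ℝ] F) →L[ℝ] G) (θ : E)
    (y : F) : gradSymbol A θ y = (Module.finrank ℝ E : ℝ) • A ((innerSL ℝ θ).smulRight y) :=
  rfl

theorem continuous_gradSymbol [NormedSpace ℝ F] [NormedSpace ℝ G] (A : (E →L[ℝ] F) →L[ℝ] G) :
    Continuous (gradSymbol A) := by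
  unfold gradSymbol
  fun_prop

theorem innerSL_smulRight_complex_smul [NormedSpace ℂ F] (θ : E) (c : ℂ) (y : F) :
    (innerSL ℝ θ).smulRight (c • y) = c • (innerSL ℝ θ).smulRight y := by
  ext v
  exact smul_comm _ _ _

theorem gradSymbol_complex_smul [NormedSpace ℂ F] [NormedSpace ℂ G] {A : (E →L[ℝ] F) →L[ℝ] G}
    (hA : ∀ (c : ℂ) B, A (c • B) = c • A B) (θ : E) (c : ℂ) (y : F) :
    gradSymbol A θ (c • y) = c • gradSymbol A θ y := by
  rw [gradSymbol_apply, gradSymbol_apply, innerSL_smulRight_complex_smul, hA, smul_comm c]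

end GradSymbol

theorem besselPhi_norm_smul {E : Type*} [NormedAddCommGroup E] [NormedSpace ℝ E] (n : ℕ) (t : ℝ)
    (ξ : E) :
    besselPhi n ‖(2 * Real.pi * t) • ξ‖ = besselPhi n (t * (2 * Real.pi * ‖ξ‖)) := by
  rw [← besselPhi_abs n (t * _), norm_smul, Real.norm_eq_abs, abs_mul, abs_mul t, abs_mul _ ‖ξ‖,
    abs_norm]
  ring_nf

section SphericalMultiplier

variable {E : Type*} [NormedAddCommGroup E] [InnerProductSpace ℝ E] [FiniteDimensional ℝ E]
  [MeasurableSpace E] [BorelSpace E] [Nontrivial E]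
  {F : Type*} [NormedAddCommGroup F] [NormedSpace ℂ F]

theorem integrable_exp_smul_smulRight_innerSL (η : E) (y : F) :
    Integrable (fun θ => Complex.exp ((inner ℝ θ η : ℝ) * Complex.I) •
      (innerSL ℝ θ).smulRight y) (sphereMeasure E) :=
  integrable_sphereMeasure_of_continuous
    (f := fun θ => Complex.exp _ • ContinuousLinearMap.smulRightL ℝ E F (innerSL ℝ θ) y)
    (by fun_prop)

variable [CompleteSpace F] {G : Type*} [NormedAddCommGroup G] [NormedSpace ℂ G] [CompleteSpace G]

theorem fourierInv_besselPhi_smul_fourier (g : SchwartzMap E F) (t : ℝ) (x : E) :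
    𝓕⁻ (fun ξ => ((besselPhi (Module.finrank ℝ E) (t * (2 * Real.pi * ‖ξ‖)) : ℝ) : ℂ) •
      𝓕 (g : E → F) ξ) x = ∫ θ, g (x + t • θ) ∂sphereMeasure E := by
  have h := fourierInv_integral_exp_smul_fourier (μ := sphereMeasure E)
    (integrable_const (ContinuousLinearMap.id ℝ F)) (fun _ _ _ => rfl) g t x
  simpa only [ContinuousLinearMap.id_apply, integral_smul_const, ← charFun_apply,
    charFun_sphereMeasure, besselPhi_norm_smul] using h

theorem integral_exp_smul_smulRight_innerSL (η : E) (y : F) :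
    ∫ θ, Complex.exp ((inner ℝ θ η : ℝ) * Complex.I) • (innerSL ℝ θ).smulRight y ∂sphereMeasure E =
      ((besselPhi (Module.finrank ℝ E + 2) ‖η‖ / Module.finrank ℝ E : ℝ) * Complex.I) •
        (innerSL ℝ η).smulRight y := by
  ext v
  have smulRight_apply (c : ℂ) (θ : E) : (c • (innerSL ℝ θ).smulRight y) v =
      ((inner ℝ θ v : ℝ) * c) • y := by
    rw [mul_smul, Complex.coe_smul]
    exact smul_comm _ _ _
  rw [ContinuousLinearMap.integral_apply (integrable_exp_smul_smulRight_innerSL η y)]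
  simp only [smulRight_apply]
  rw [integral_smul_const, integral_inner_mul_exp_sphereMeasure]
  congr 1
  push_cast
  ring

theorem integral_exp_smul_gradSymbol {A : (E →L[ℝ] F) →L[ℝ] G}
    (hA : ∀ (c : ℂ) B, A (c • B) = c • A B) (η : E) (y : F) :
    ∫ θ, Complex.exp ((inner ℝ θ η : ℝ) * Complex.I) • gradSymbol A θ y ∂sphereMeasure E =
      ((besselPhi (Module.finrank ℝ E + 2) ‖η‖ : ℝ) * Complex.I) •
        A ((innerSL ℝ η).smulRight y) := by
  have hn : (Module.finrank ℝ E : ℂ) ≠ 0 := Nat.cast_ne_zero.2 Module.finrank_pos.ne'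
  simp only [gradSymbol_apply, smul_comm _ (Module.finrank ℝ E : ℝ), ← hA]
  rw [integral_smul, A.integral_comp_comm (integrable_exp_smul_smulRight_innerSL η y),
    integral_exp_smul_smulRight_innerSL, ← map_smul, Nat.cast_smul_eq_nsmul,
    ← Nat.cast_smul_eq_nsmul ℂ, smul_smul]
  congr 2
  push_cast
  field_simp

theorem smul_fourierInv_besselPhi_smul_fourier_fderiv {A : (E →L[ℝ] F) →L[ℝ] G}
    (hA : ∀ (c : ℂ) B, A (c • B) = c • A B) (g : SchwartzMap E F) (t : ℝ) (x : E) :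
    t • 𝓕⁻ (fun ξ => ((besselPhi (Module.finrank ℝ E + 2) (t * (2 * Real.pi * ‖ξ‖)) : ℝ) : ℂ) •
      𝓕 (fun y => A (fderiv ℝ g y)) ξ) x =
      ∫ θ, gradSymbol A θ (g (x + t • θ)) ∂sphereMeasure E := by
  have fourier_fderiv (ξ : E) : 𝓕 (fderiv ℝ g) ξ =
      (2 * Real.pi * Complex.I) • (innerSL ℝ ξ).smulRight (𝓕 (g : E → F) ξ) := by
    rw [Real.fourier_fderiv g.integrable g.differentiable
      (SchwartzMap.fderivCLM ℝ E F g).integrable]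
    ext v
    simp [mul_smul, innerSL_apply_apply ℝ]
  have hA_smul (ξ : E) : A ((innerSL ℝ ((2 * Real.pi * t) • ξ)).smulRight (𝓕 (g : E → F) ξ)) =
      (2 * Real.pi * t) • A ((innerSL ℝ ξ).smulRight (𝓕 (g : E → F) ξ)) := by
    rw [← map_smul]
    congr 1
    ext v
    simp [mul_smul]
  rw [← fourierInv_integral_exp_smul_fourier
    (integrable_sphereMeasure_of_continuous (continuous_gradSymbol A)) (gradSymbol_complex_smul hA)
    g t x, Real.fourierInv_eq', Real.fourierInv_eq', ← integral_smul]
  congr 1 with ξ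
  rw [integral_exp_smul_gradSymbol hA, besselPhi_norm_smul, hA_smul,
    fourier_clm_comp A hA (f := fderiv ℝ g) (SchwartzMap.fderivCLM ℝ E F g).integrable,
    fourier_fderiv, hA]
  module

end SphericalMultiplier

theorem rpow_lintegral_le_lintegral_rpow {α : Type*} [MeasurableSpace α] {ν : Measure α}
    [IsProbabilityMeasure ν] {p : ℝ} (hp : 1 ≤ p) {f : α → ENNReal} (hf : AEMeasurable f ν) :
    (∫⁻ a, f a ∂ν) ^ p ≤ ∫⁻ a, f a ^ p ∂ν := by
  have h := eLpNorm'_le_eLpNorm'_of_exponent_le one_pos hp ν hf.aestronglyMeasurable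
  simp only [eLpNorm', enorm_eq_self, ENNReal.rpow_one, div_one, one_div] at h
  rwa [ENNReal.le_rpow_inv_iff (one_pos.trans_le hp)] at h

theorem lintegral_rpow_lintegral_add_smul_le {E : Type*} [NormedAddCommGroup E] [NormedSpace ℝ E]
    [MeasurableSpace E] [BorelSpace E] [SecondCountableTopology E] {μ ν : Measure E} [SFinite μ]
    [μ.IsAddRightInvariant] [IsProbabilityMeasure ν] {p : ℝ} (hp : 1 ≤ p) {f : E → ENNReal}
    (hf : Measurable f) (t : ℝ) :
    ∫⁻ x, (∫⁻ θ, f (x + t • θ) ∂ν) ^ p ∂μ ≤ ∫⁻ x, f x ^ p ∂μ :=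
  calc ∫⁻ x, (∫⁻ θ, f (x + t • θ) ∂ν) ^ p ∂μ
      ≤ ∫⁻ x, ∫⁻ θ, f (x + t • θ) ^ p ∂ν ∂μ :=
        lintegral_mono fun x => rpow_lintegral_le_lintegral_rpow hp (by fun_prop)
    _ = ∫⁻ θ, ∫⁻ x, f (x + t • θ) ^ p ∂μ ∂ν := lintegral_lintegral_swap (by fun_prop)
    _ = ∫⁻ x, f x ^ p ∂μ := by
        simp only [lintegral_add_right_eq_self fun x => f x ^ p, lintegral_const, measure_univ,
          mul_one]

theorem exists_nnnorm_le_on_unitSphere {E F : Type*} [NormedAddCommGroup E] [ProperSpace E]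
    [NormedAddCommGroup F] {S : E → F} (hS : Continuous S) :
    ∃ C : NNReal, ∀ θ ∈ Metric.sphere 0 1, ‖S θ‖₊ ≤ C := by
  obtain ⟨C, hC⟩ := (isCompact_sphere (0 : E) 1).bddAbove_image hS.nnnorm.continuousOn
  exact ⟨C, fun θ hθ => hC (Set.mem_image_of_mem _ hθ)⟩

section SphericalMean

variable {E : Type*} [NormedAddCommGroup E] [InnerProductSpace ℝ E] [FiniteDimensional ℝ E]
  [MeasurableSpace E] [BorelSpace E] {F : Type*} [NormedAddCommGroup F] [NormedSpace ℝ F]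
  {G : Type*} [NormedAddCommGroup G] [NormedSpace ℝ G]

/-- The mean of `f` over the sphere of radius `t` and centre `x`, with operator weight `S θ` in the
direction `θ`. -/
noncomputable def sphericalMean (t : ℝ) (S : E → F →L[ℝ] G) (f : E → F) (x : E) : G :=
  ∫ θ, S θ (f (x + t • θ)) ∂sphereMeasure E

variable [Nontrivial E]

theorem sphericalMean_congr {t : ℝ} (ht : 0 ≤ t) (S : E → F →L[ℝ] G) {f g : E → F} {p : E}
    (h : Set.EqOn f g (Metric.sphere p t)) : sphericalMean t S f p = sphericalMean t S g p := by
  refine integral_congr_ae ?_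
  filter_upwards [ae_sphereMeasure_norm_eq_one E] with θ hθ
  rw [h]
  simp [norm_smul, hθ, abs_of_nonneg ht]

theorem continuous_sphericalMean (t : ℝ) {S : E → F →L[ℝ] G} (hS : Continuous S) {f : E → F}
    (hf : Continuous f) : Continuous (sphericalMean t S f) := by
  have h := continuous_parametric_integral_of_continuous (μ := sphereMeasure E)
    (f := fun x θ => S θ (f (x + t • θ))) (by fun_prop) (isCompact_sphere 0 1)
  rwa [restrict_sphere_sphereMeasure] at h

theorem sphericalMean_sub (t : ℝ) {S : E → F →L[ℝ] G} (hS : Continuous S) {f g : E → F}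
    (hf : Continuous f) (hg : Continuous g) :
    sphericalMean t S (f - g) = sphericalMean t S f - sphericalMean t S g := by
  funext x
  simp only [sphericalMean, Pi.sub_apply, map_sub]
  exact integral_sub (integrable_sphereMeasure_of_continuous (by fun_prop))
    (integrable_sphereMeasure_of_continuous (by fun_prop))

theorem enorm_sphericalMean_le {t : ℝ} {S : E → F →L[ℝ] G} {C : NNReal}
    (hC : ∀ θ ∈ Metric.sphere 0 1, ‖S θ‖₊ ≤ C) (f : E → F) (x : E) :
    ‖sphericalMean t S f x‖ₑ ≤ C * ∫⁻ θ, ‖f (x + t • θ)‖ₑ ∂sphereMeasure E := by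
  rw [← lintegral_const_mul' _ _ ENNReal.coe_ne_top]
  refine (enorm_integral_le_lintegral_enorm _).trans (lintegral_mono_ae ?_)
  filter_upwards [ae_sphereMeasure_norm_eq_one E] with θ hθ
  refine (ContinuousLinearMap.le_opENorm _ _).trans ?_
  gcongr
  exact ENNReal.coe_le_coe.2 (hC θ (mem_sphere_zero_iff_norm.2 hθ))

theorem eLpNorm_sphericalMean_le {t : ℝ} {S : E → F →L[ℝ] G} {C : NNReal}
    (hC : ∀ θ ∈ Metric.sphere 0 1, ‖S θ‖₊ ≤ C) {f : E → F} (hf : Continuous f) {p : ENNReal}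
    (hp : 1 ≤ p) (hp_top : p ≠ ⊤) :
    eLpNorm (sphericalMean t S f) p volume ≤ C * eLpNorm f p volume := by
  have hp_real : 1 ≤ p.toReal := by
    rwa [← ENNReal.ofReal_le_iff_le_toReal hp_top, ENNReal.ofReal_one]
  have hp_pos : 0 < p.toReal := one_pos.trans_le hp_real
  have hp_zero : p ≠ 0 := (one_pos.trans_le hp).ne'
  rw [eLpNorm_eq_lintegral_rpow_enorm_toReal hp_zero hp_top,
    eLpNorm_eq_lintegral_rpow_enorm_toReal hp_zero hp_top, one_div,
    ENNReal.rpow_inv_le_iff hp_pos, ENNReal.mul_rpow_of_nonneg _ _ hp_pos.le,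
    ENNReal.rpow_inv_rpow hp_pos.ne']
  calc ∫⁻ x, ‖sphericalMean t S f x‖ₑ ^ p.toReal
      ≤ ∫⁻ x, (C * ∫⁻ θ, ‖f (x + t • θ)‖ₑ ∂sphereMeasure E) ^ p.toReal := by
        gcongr with x
        exact enorm_sphericalMean_le hC f x
    _ = (C : ENNReal) ^ p.toReal *
        ∫⁻ x, (∫⁻ θ, ‖f (x + t • θ)‖ₑ ∂sphereMeasure E) ^ p.toReal := by
        simp only [ENNReal.mul_rpow_of_nonneg _ _ hp_pos.le]
        exact lintegral_const_mul' _ _ (ENNReal.rpow_ne_top_of_nonneg hp_pos.le ENNReal.coe_ne_top)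
    _ ≤ (C : ENNReal) ^ p.toReal * ∫⁻ x, ‖f x‖ₑ ^ p.toReal :=
        mul_le_mul' le_rfl (lintegral_rpow_lintegral_add_smul_le hp_real hf.enorm.measurable t)

theorem memLp_sphericalMean (t : ℝ) {S : E → F →L[ℝ] G} (hS : Continuous S) {f : E → F}
    (hf : Continuous f) {p : ENNReal} (hp : 1 ≤ p) (hp_top : p ≠ ⊤) (hfp : MemLp f p volume) :
    MemLp (sphericalMean t S f) p volume := by
  obtain ⟨C, hC⟩ := exists_nnnorm_le_on_unitSphere hS
  exact ⟨(continuous_sphericalMean t hS hf).aestronglyMeasurable,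
    (eLpNorm_sphericalMean_le hC hf hp hp_top).trans_lt
      (ENNReal.mul_lt_top ENNReal.coe_lt_top hfp.eLpNorm_lt_top)⟩

theorem tendsto_eLpNorm_sphericalMean_sub {ι : Type*} {l : Filter ι} (t : ℝ) {S : E → F →L[ℝ] G}
    (hS : Continuous S) {f : E → F} (hf : Continuous f) {g : ι → E → F}
    (hg : ∀ j, Continuous (g j)) {p : ENNReal} (hp : 1 ≤ p) (hp_top : p ≠ ⊤)
    (h : Tendsto (fun j => eLpNorm (g j - f) p volume) l (𝓝 0)) :
    Tendsto (fun j => eLpNorm (sphericalMean t S (g j) - sphericalMean t S f) p volume) l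
      (𝓝 0) := by
  obtain ⟨C, hC⟩ := exists_nnnorm_le_on_unitSphere hS
  have upper : Tendsto (fun j => C * eLpNorm (g j - f) p volume) l (𝓝 0) := by
    simpa using ENNReal.Tendsto.const_mul h (Or.inr ENNReal.coe_ne_top)
  refine tendsto_of_tendsto_of_tendsto_of_le_of_le tendsto_const_nhds upper (fun _ => zero_le)
    fun j => ?_
  simp only [← sphericalMean_sub t hS (hg j) hf]
  exact eLpNorm_sphericalMean_le hC ((hg j).sub hf) hp hp_top

end SphericalMean

theorem exists_seq_contDiff_tendsto_eLpNorm_sub {E F : Type*} [NormedAddCommGroup E]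
    [NormedSpace ℝ E] [FiniteDimensional ℝ E] [MeasurableSpace E] [BorelSpace E]
    [NormedAddCommGroup F] [NormedSpace ℝ F] {μ : Measure E} [IsFiniteMeasureOnCompacts μ]
    {f : E → F} {p : ENNReal} (hp : 1 ≤ p) (hp_top : p ≠ ⊤) (hf : MemLp f p μ) :
    ∃ g : ℕ → E → F, (∀ j, ContDiff ℝ ∞ (g j) ∧ HasCompactSupport (g j)) ∧
      Tendsto (fun j => eLpNorm (g j - f) p μ) atTop (𝓝 0) := by
  choose g hg_supp hg_smooth hg_le using fun j : ℕ =>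
    hf.exist_eLpNorm_sub_le hp_top hp (Nat.one_div_pos_of_nat (α := ℝ) (n := j))
  refine ⟨g, fun j => ⟨hg_smooth j, hg_supp j⟩, ?_⟩
  have upper : Tendsto (fun j : ℕ => ENNReal.ofReal (1 / ((j : ℝ) + 1))) atTop (𝓝 0) := by
    simpa using ENNReal.tendsto_ofReal tendsto_one_div_add_atTop_nhds_zero_nat
  refine tendsto_of_tendsto_of_tendsto_of_le_of_le tendsto_const_nhds upper (fun _ => zero_le)
    fun j => ?_
  simpa only [eLpNorm_sub_comm (g j) f] using hg_le j

theorem eq_of_tendsto_eLpNorm_sub {X F ι : Type*} [TopologicalSpace X] [SecondCountableTopology X]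
    [MeasurableSpace X] [OpensMeasurableSpace X] [NormedAddCommGroup F] {μ : Measure X}
    [μ.IsOpenPosMeasure] {p : ENNReal} (hp : p ≠ 0) {l : Filter ι} [l.NeBot]
    [l.IsCountablyGenerated] {u v : X → F} (hu : Continuous u) (hv : Continuous v)
    {g : ι → X → F} (hg : ∀ j, Continuous (g j))
    (hgu : Tendsto (fun j => eLpNorm (g j - u) p μ) l (𝓝 0))
    (hgv : Tendsto (fun j => eLpNorm (g j - v) p μ) l (𝓝 0)) : u = v := by
  have hg_meas (j : ι) : AEStronglyMeasurable (g j) μ := (hg j).aestronglyMeasurable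
  exact (hu.ae_eq_iff_eq μ hv).1 <| tendstoInMeasure_ae_unique
    (tendstoInMeasure_of_tendsto_eLpNorm hp hg_meas hu.aestronglyMeasurable hgu)
    (tendstoInMeasure_of_tendsto_eLpNorm hp hg_meas hv.aestronglyMeasurable hgv)

section DifferentialForms

variable {q k l : ℕ}

theorem continuous_extDeriv {f : EucSpace q → KForm q k} (hf : ContDiff ℝ 1 f) :
    Continuous (extDeriv f) :=
  (ContinuousAlternatingMap.alternatizeUncurryFinCLM ℝ (EucSpace q) ℂ).continuous.comp
    (hf.continuous_fderiv one_ne_zero)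

theorem extDeriv_eqOn_sphere {f g : EucSpace q → KForm q k} {p : EucSpace q} {t : ℝ} (ht : t ≠ 0)
    (hf : Differentiable ℝ f) (hg : Differentiable ℝ g)
    (h : ∀ x ∈ Metric.sphere p t, f x = g x ∧ fderiv ℝ f x (x - p) = fderiv ℝ g x (x - p)) :
    Set.EqOn (extDeriv f) (extDeriv g) (Metric.sphere p t) := fun x hx => by
  rw [extDeriv, extDeriv, fderiv_eq_of_eqOn_sphere ht (hf x) (hg x) hx (fun y hy => (h y hy).1)
    (h x hx).2]

variable [NeZero q]

theorem evenDiracCalculus_besselPhi_eq_sphericalMean (t : ℝ) {g : EucSpace q → KForm q k}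
    (hg : IsTestForm g) :
    evenDiracCalculus (besselPhi q) t g =
      sphericalMean t (fun _ => ContinuousLinearMap.id ℝ (KForm q k)) g := by
  funext x
  have h := fourierInv_besselPhi_smul_fourier (hg.2.toSchwartzMap hg.1) t x
  rwa [finrank_euclideanSpace_fin] at h

theorem deformedExtDeriv_eq_sphericalMean (t : ℝ) {g : EucSpace q → KForm q k}
    (hg : IsTestForm g) :
    deformedExtDeriv t g = sphericalMean t
      (gradSymbol (ContinuousAlternatingMap.alternatizeUncurryFinCLM ℝ (EucSpace q) ℂ)) g := by
  funext x
  have h := smul_fourierInv_besselPhi_smul_fourier_fderiv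
    (A := ContinuousAlternatingMap.alternatizeUncurryFinCLM ℝ (n := k) (EucSpace q) ℂ)
    ContinuousAlternatingMap.alternatizeUncurryFin_smul (hg.2.toSchwartzMap hg.1) t x
  rwa [finrank_euclideanSpace_fin] at h

variable {t : ℝ} {T : (EucSpace q → KForm q k) → (EucSpace q → KForm q l)}
  {S : EucSpace q → KForm q k →L[ℝ] KForm q l}

theorem isL2Extension_sphericalMean (hS : Continuous S)
    (hT : ∀ g, IsTestForm g → T g = sphericalMean t S g) {f : EucSpace q → KForm q k}
    (hf : Continuous f) (hf₂ : MemLp f 2 volume) : IsL2Extension T f (sphericalMean t S f) := by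
  obtain ⟨g, hg, hgf⟩ :=
    exists_seq_contDiff_tendsto_eLpNorm_sub one_le_two ENNReal.ofNat_ne_top hf₂
  refine ⟨hf₂, memLp_sphericalMean t hS hf one_le_two ENNReal.ofNat_ne_top hf₂, g, hg, hgf, ?_⟩
  simp only [fun j => hT (g j) (hg j)]
  exact tendsto_eLpNorm_sphericalMean_sub t hS hf (fun j => (hg j).1.continuous) one_le_two
    ENNReal.ofNat_ne_top hgf

theorem IsL2Extension.eq_sphericalMean {f : EucSpace q → KForm q k} {u : EucSpace q → KForm q l}
    (h : IsL2Extension T f u) (hS : Continuous S)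
    (hT : ∀ g, IsTestForm g → T g = sphericalMean t S g) (hf : Continuous f) (hu : Continuous u) :
    u = sphericalMean t S f := by
  obtain ⟨-, -, g, hg, hgf, hgu⟩ := h
  have hg_cont (j : ℕ) : Continuous (g j) := (hg j).1.continuous
  simp only [fun j => hT (g j) (hg j)] at hgu
  exact eq_of_tendsto_eLpNorm_sub two_ne_zero hu (continuous_sphericalMean t hS hf)
    (fun j => continuous_sphericalMean t hS (hg_cont j)) hgu
    (tendsto_eLpNorm_sphericalMean_sub t hS hf hg_cont one_le_two ENNReal.ofNat_ne_top hgf)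

theorem existsUnique_continuous_isL2Extension (hS : Continuous S)
    (hT : ∀ g, IsTestForm g → T g = sphericalMean t S g) {f : EucSpace q → KForm q k}
    (hf : Continuous f) (hf₂ : MemLp f 2 volume) :
    ∃! u : EucSpace q → KForm q l, Continuous u ∧ IsL2Extension T f u :=
  ⟨sphericalMean t S f,
    ⟨continuous_sphericalMean t hS hf, isL2Extension_sphericalMean hS hT hf hf₂⟩,
    fun _ hu => hu.2.eq_sphericalMean hS hT hf hu.1⟩

theorem IsL2Extension.apply_eq_of_eqOn_sphere {f₁ f₂ : EucSpace q → KForm q k}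
    {u₁ u₂ : EucSpace q → KForm q l} (h₁ : IsL2Extension T f₁ u₁) (h₂ : IsL2Extension T f₂ u₂)
    (ht : 0 ≤ t) (hS : Continuous S) (hT : ∀ g, IsTestForm g → T g = sphericalMean t S g)
    (hf₁ : Continuous f₁) (hf₂ : Continuous f₂) (hu₁ : Continuous u₁) (hu₂ : Continuous u₂)
    {p : EucSpace q} (h : Set.EqOn f₁ f₂ (Metric.sphere p t)) : u₁ p = u₂ p := by
  rw [h₁.eq_sphericalMean hS hT hf₁ hu₁, h₂.eq_sphericalMean hS hT hf₂ hu₂]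
  exact sphericalMean_congr ht S h

end DifferentialForms

theorem theorem2 (q : ℕ) (hq : 1 ≤ q) (k : ℕ) (t : ℝ) (ht : 0 < t) :
    ((∀ f : EucSpace q → KForm q k, Continuous f → MemLp f 2 volume →
        ∃! u : EucSpace q → KForm q (k + 1),
          Continuous u ∧ IsL2Extension (deformedExtDeriv t) f u) ∧
      (∀ (f₁ f₂ : EucSpace q → KForm q k) (u₁ u₂ : EucSpace q → KForm q (k + 1)),
        Continuous f₁ → Continuous f₂ → Continuous u₁ → Continuous u₂ →
        IsL2Extension (deformedExtDeriv t) f₁ u₁ →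
        IsL2Extension (deformedExtDeriv t) f₂ u₂ →
        ∀ p : EucSpace q, (∀ x ∈ Metric.sphere p t, f₁ x = f₂ x) → u₁ p = u₂ p)) ∧
    ((∀ f : EucSpace q → KForm q k, ContDiff ℝ 1 f → MemLp (extDeriv f) 2 volume →
        ∃! u : EucSpace q → KForm q (k + 1),
          Continuous u ∧ IsL2Extension (evenDiracCalculus (besselPhi q) t) (extDeriv f) u) ∧
      (∀ (f₁ f₂ : EucSpace q → KForm q k) (u₁ u₂ : EucSpace q → KForm q (k + 1)),
        ContDiff ℝ 1 f₁ → ContDiff ℝ 1 f₂ → Continuous u₁ → Continuous u₂ →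
        IsL2Extension (evenDiracCalculus (besselPhi q) t) (extDeriv f₁) u₁ →
        IsL2Extension (evenDiracCalculus (besselPhi q) t) (extDeriv f₂) u₂ →
        ∀ p : EucSpace q,
          (∀ x ∈ Metric.sphere p t,
            f₁ x = f₂ x ∧ fderiv ℝ f₁ x (x - p) = fderiv ℝ f₂ x (x - p)) →
          u₁ p = u₂ p)) := by
  have : NeZero q := ⟨Nat.one_le_iff_ne_zero.1 hq⟩
  have hS_d := continuous_gradSymbol
    (ContinuousAlternatingMap.alternatizeUncurryFinCLM ℝ (n := k) (EucSpace q) ℂ)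
  have hT_d (g : EucSpace q → KForm q k) := deformedExtDeriv_eq_sphericalMean (g := g) t
  have hS_φ : Continuous fun _ : EucSpace q => ContinuousLinearMap.id ℝ (KForm q (k + 1)) :=
    continuous_const
  have hT_φ (g : EucSpace q → KForm q (k + 1)) :=
    evenDiracCalculus_besselPhi_eq_sphericalMean (g := g) t
  refine ⟨⟨fun f hf hf₂ => existsUnique_continuous_isL2Extension hS_d hT_d hf hf₂, ?_⟩,
    fun f hf hdf => existsUnique_continuous_isL2Extension hS_φ hT_φ (continuous_extDeriv hf) hdf,
    ?_⟩
  · intro f₁ f₂ u₁ u₂ hf₁ hf₂ hu₁ hu₂ h₁ h₂ p h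
    exact h₁.apply_eq_of_eqOn_sphere h₂ ht.le hS_d hT_d hf₁ hf₂ hu₁ hu₂ h
  · intro f₁ f₂ u₁ u₂ hf₁ hf₂ hu₁ hu₂ h₁ h₂ p h
    exact h₁.apply_eq_of_eqOn_sphere h₂ ht.le hS_φ hT_φ (continuous_extDeriv hf₁)
      (continuous_extDeriv hf₂) hu₁ hu₂ <| extDeriv_eqOn_sphere ht.ne'
        (hf₁.differentiable one_ne_zero) (hf₂.differentiable one_ne_zero) h
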